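/- Let $p_1,\dots,p_m>0$ be real numbers with $\sum_{i=1}^m p_i=1$ that are linearly independent over $\mathbb{Q}$ (the relative sizes of $m$ states). For $n\ge 1$ let $s_i(n)$ be the number of seats that state $i$ receives when $n$ seats are distributed by Hamilton's method (the method of largest remainder): state $i$ first receives $\lfloor np_i\rfloor$ seats, and the remaining $n-\sum_j\lfloor np_j\rfloor$ seats are given, one each, to the states with the largest remainders $np_i-\lfloor np_i\rfloor$. (By linear independence no ties occur.) Let $\nu_i(N)$ be the number of integers $n$ with $1\le n<N$ and $s_i(n+1)<s_i(n)$. Then for every $i$ the limit $$q_i=\lim_{N\to\infty}\frac{\nu_i(N)}{N},$$ the probability that state $i$ suffers from the Alabama paradox, exists, and $$q_i=\frac1m\,\mathbb{E}\bigl(S_i^- - S_i^+ - 1\bigr)_+,\qquad S_i^+=\sum_{j:\,p_j<p_i} I_j^{(i)},\quad S_i^-=\sum_{j:\,p_j>p_i} I_j^{(i)},$$ where $x_+=\max\{x,0\}$ and $I_1^{(i)},\dots,I_m^{(i)}$ are independent random variables with $\mathbb{P}(I_j^{(i)}=1)=|p_i-p_j|$ and $\mathbb{P}(I_j^{(i)}=0)=1-|p_i-p_j|$.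 More explicitly, let $p_{(1)}\ge p_{(2)}\ge\dots\ge p_{(m)}$ be the sizes in decreasing order and let $q_{(1)},\dots,q_{(m)}$ be the corresponding probabilities. Then for $1\le i\le m$ $$q_{(i)}=\frac1m\sum_{s=0}^{m-i}\ \sum_{k=2}^{i-1}(-1)^{s+k}\binom{s+k-2}{s}\,e_k\bigl(r_1^{(i)},\dots,r_{i-1}^{(i)}\bigr)\,e_s\bigl(r_{i+1}^{(i)},\dots,r_m^{(i)}\bigr),$$ where $r_j^{(i)}=|p_{(i)}-p_{(j)}|$, $e_k(x_1,\dots,x_l)=\sum_{1\le j_1<\dots<j_k\le l}x_{j_1}\cdots x_{j_k}$ is the elementary symmetric polynomial of degree $k$, and empty sums are $0$. -/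

import Mathlib

open Filter MeasureTheory ProbabilityTheory
open scoped Topology

noncomputable section

/-- The remainder `μ_i - ⌊μ_i⌋` of state `i`, where `μ_i = n p_i` is the exact proportional share
of state `i` when `n` seats are distributed. -/
def remainder {m : ℕ} (p : Fin m → ℝ) (n : ℕ) (i : Fin m) : ℝ :=
  Int.fract ((n : ℝ) * p i)

open Classical in
/-- The states that come before state `i` when the seats left over after rounding down are handed
out: those with a larger remainder. States with equal remainders are taken in the fixed order of
their indices. -/
def ahead {m : ℕ} (p : Fin m → ℝ) (n : ℕ) (i : Fin m) : Finset (Fin m) :=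
  Finset.univ.filter fun j =>
    remainder p n i < remainder p n j ∨ (remainder p n j = remainder p n i ∧ j < i)

/-- The number of seats left over when every share `n p_j` is rounded down. -/
def leftover {m : ℕ} (p : Fin m → ℝ) (n : ℕ) : ℤ :=
  (n : ℤ) - ∑ j, ⌊(n : ℝ) * p j⌋

/-- The number `s_i(n)` of seats that state `i` receives under Hamilton's method (the method of
largest remainder) when `n` seats are distributed among `m` states of relative sizes `p`: the share
`n p_i` is rounded down, and one more seat is given if state `i` is among the `leftover p n` states
with the largest remainders. -/
def seats {m : ℕ} (p : Fin m → ℝ) (n : ℕ) (i : Fin m) : ℤ :=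
  ⌊(n : ℝ) * p i⌋ + if ((ahead p n i).card : ℤ) < leftover p n then 1 else 0

open Classical in
/-- The number `ν_i(N)` of times that state `i` suffers from the Alabama paradox when the number of
seats grows, one seat at a time, from `1` to `N`. -/
def paradoxCount {m : ℕ} (p : Fin m → ℝ) (i : Fin m) (N : ℕ) : ℕ :=
  ((Finset.Ico 1 N).filter fun n => seats p (n + 1) i < seats p n i).card

/-- `q` is the probability that state `i` suffers from the Alabama paradox: the proportion of
`n < N` for which state `i` loses a seat when `n` is increased to `n + 1` tends to `q`. -/
def IsParadoxProbability {m : ℕ} (p : Fin m → ℝ) (i : Fin m) (q : ℝ) : Prop :=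
  Tendsto (fun N : ℕ => (paradoxCount p i N : ℝ) / (N : ℝ)) atTop (𝓝 q)

/-- `X` has the Bernoulli distribution `Be(r)` under `P`: it takes the value `1` with probability
`r` and the value `0` with probability `1 - r` (in particular `0 ≤ r ≤ 1`). -/
def IsBernoulli {Ω : Type*} [MeasurableSpace Ω] (P : Measure Ω) (X : Ω → ℝ) (r : ℝ) : Prop :=
  ∃ t : unitInterval, (t : ℝ) = r ∧ HasLaw X (bernoulliMeasure (1 : ℝ) 0 t) P

/-- `e_k` of the family `(x_j)_{j ∈ s}`: the elementary symmetric polynomial of degree `k`. -/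
def elemSymm {m : ℕ} (s : Finset (Fin m)) (x : Fin m → ℝ) (k : ℕ) : ℝ :=
  (s.val.map x).esymm k

end

/-! ### Weyl equidistribution on the torus -/

/-! Fix a state `i` and put `d j = p j - p i` for `j ≠ i`. Subtracting floors costs a borrow exactly
when the remainder of `j` is below that of `i` (`floor_mul_sub`), so `A(n) = n - ∑ ⌊n d j⌋` equals
`m ⌊n p i⌋` plus the leftover seats plus the number of states behind `i`. Hence Hamilton's rule is
one integer division, `s_i(n) = ⌊A(n) / m⌋` (`seats_eq_floorDefect_div`).

From `n` to `n + 1` each `⌊n d j⌋` moves by at most one, in the direction of the sign of `d j`, so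
`A` drops by `h = S⁻ - S⁺ - 1`, where `S⁻` and `S⁺` count the larger and the smaller states whose
floor moves. A seat is lost exactly when `A(n) % m < h`.

The `d j` and `1` are linearly independent over `ℚ`. Weyl equidistribution of `n d j / m` along each
residue class of `n` modulo `m` makes the residues `⌊n d j⌋ % m` uniform and the moves independent
of them and of each other, with probabilities `|d j|`. Averaging over the class of `n` makes `A(n) %
m` uniform given `h`, so a loss has conditional probability `h₊ / m` (`tendsto_frequency_descent`).

For the explicit formula, `(a - b - 1)₊` is expanded in the products `a.choose k * b.choose s`
(`binomialTransform_positivePartCoeff`), whose expectations at `a = S⁻`, `b = S⁺` are products of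
elementary symmetric polynomials (`sum_patternWeight_choose_mul_choose`). -/

instance UnitAddCircle.isProbabilityMeasure_volume :
    IsProbabilityMeasure (volume : Measure UnitAddCircle) :=
  ⟨UnitAddCircle.measure_univ⟩

section Weyl

variable {κ : Type*}

/-- The `l`-th point of the orbit of the rotation by `α` started at `β`. -/
noncomputable def rotationOrbit (α β : κ → ℝ) (l : ℕ) : κ → UnitAddCircle :=
  fun j => ((l * α j + β j : ℝ) : UnitAddCircle)

theorem rotationOrbit_eq (α β : κ → ℝ) (l : ℕ) :
    rotationOrbit α β l =
      l • (fun j => (α j : UnitAddCircle)) + fun j => (β j : UnitAddCircle) := by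
  funext j
  simp [rotationOrbit]

/-- The average of `f` over the first `N` points of an orbit. -/
noncomputable def orbitAverage (α β : κ → ℝ) (f : (κ → UnitAddCircle) → ℂ) (N : ℕ) : ℂ :=
  (N : ℂ)⁻¹ * ∑ l ∈ Finset.range N, f (rotationOrbit α β l)

theorem orbitAverage_add (α β : κ → ℝ) (f g : (κ → UnitAddCircle) → ℂ) (N : ℕ) :
    orbitAverage α β (fun x => f x + g x) N = orbitAverage α β f N + orbitAverage α β g N := by
  simp [orbitAverage, Finset.sum_add_distrib, mul_add]

theorem orbitAverage_const_mul (α β : κ → ℝ) (c : ℂ) (f : (κ → UnitAddCircle) → ℂ) (N : ℕ) :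
    orbitAverage α β (fun x => c * f x) N = c * orbitAverage α β f N := by
  simp [orbitAverage, ← Finset.mul_sum, mul_left_comm]

theorem norm_orbitAverage_le (α β : κ → ℝ) {f : (κ → UnitAddCircle) → ℂ} {C : ℝ} (hC : 0 ≤ C)
    (hf : ∀ x, ‖f x‖ ≤ C) (N : ℕ) : ‖orbitAverage α β f N‖ ≤ C := by
  rcases N.eq_zero_or_pos with rfl | hN
  · simpa [orbitAverage] using hC
  have hN' : (0 : ℝ) < N := by exact_mod_cast hN
  rw [orbitAverage, norm_mul, norm_inv, Complex.norm_natCast, inv_mul_le_iff₀ hN']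
  refine (norm_sum_le _ _).trans ((Finset.sum_le_card_nsmul _ _ C fun l _ => hf _).trans_eq ?_)
  simp

variable [Fintype κ]

theorem mFourier_add_apply (k : κ → ℤ) (x y : κ → UnitAddCircle) :
    UnitAddTorus.mFourier k (x + y) = UnitAddTorus.mFourier k x * UnitAddTorus.mFourier k y := by
  simp [UnitAddTorus.mFourier, fourier_apply, smul_add, AddCircle.toCircle_add,
    Finset.prod_mul_distrib]

theorem mFourier_nsmul_apply (k : κ → ℤ) (x : κ → UnitAddCircle) (l : ℕ) :
    UnitAddTorus.mFourier k (l • x) = UnitAddTorus.mFourier k x ^ l := by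
  induction l with
  | zero => simp [UnitAddTorus.mFourier]
  | succ l ih => rw [succ_nsmul, mFourier_add_apply, ih, pow_succ]

theorem mFourier_coe (k : κ → ℤ) (α : κ → ℝ) :
    UnitAddTorus.mFourier k (fun j => (α j : UnitAddCircle)) =
      (AddCircle.toCircle ((∑ j, k j * α j : ℝ) : UnitAddCircle) : ℂ) := by
  rw [← fourier_one]
  simp only [UnitAddTorus.mFourier, ContinuousMap.coe_mk, fourier_coe_apply]
  rw [← Complex.exp_sum]
  congr 1
  push_cast
  rw [Finset.mul_sum, Finset.sum_div]
  exact Finset.sum_congr rfl fun j _ => by ring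

theorem mFourier_coe_ne_one {α : κ → ℝ} {k : κ → ℤ} (h : ∀ z : ℤ, ∑ j, k j * α j ≠ z) :
    UnitAddTorus.mFourier k (fun j => (α j : UnitAddCircle)) ≠ 1 := by
  rw [mFourier_coe]
  intro h1
  have h2 : AddCircle.toCircle ((∑ j, k j * α j : ℝ) : UnitAddCircle) =
      AddCircle.toCircle (0 : UnitAddCircle) := by
    rw [AddCircle.toCircle_zero]
    exact Circle.ext (h1.trans Circle.coe_one.symm)
  obtain ⟨z, hz⟩ := (AddCircle.coe_eq_zero_iff _).1 (AddCircle.injective_toCircle one_ne_zero h2)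
  exact h z (by simpa using hz.symm)

/-- Translation by `α` preserves the integral but multiplies it by a factor different from `1`. -/
theorem integral_mFourier_eq_zero {α : κ → ℝ} {k : κ → ℤ} (h : ∀ z : ℤ, ∑ j, k j * α j ≠ z) :
    ∫ x : κ → UnitAddCircle, UnitAddTorus.mFourier k x = 0 := by
  have h1 := integral_add_right_eq_self (μ := (volume : Measure (κ → UnitAddCircle)))
    (fun x => UnitAddTorus.mFourier k x) (fun j => (α j : UnitAddCircle))
  simp only [mFourier_add_apply, integral_mul_const] at h1
  have h2 := mFourier_coe_ne_one h
  by_contra h3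
  exact h2 (mul_left_cancel₀ h3 (by simpa using h1))

theorem tendsto_orbitAverage_mFourier {α : κ → ℝ} (β : κ → ℝ)
    (hα : ∀ k : κ → ℤ, ∀ z : ℤ, ∑ j, k j * α j = z → k = 0) (k : κ → ℤ) :
    Tendsto (orbitAverage α β (UnitAddTorus.mFourier k)) atTop
      (𝓝 (∫ x : κ → UnitAddCircle, UnitAddTorus.mFourier k x)) := by
  by_cases hk : k = 0
  · subst hk
    simp only [UnitAddTorus.mFourier_zero, ContinuousMap.one_apply, integral_const, probReal_univ,
      one_smul]
    refine tendsto_const_nhds.congr' ?_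
    filter_upwards [eventually_gt_atTop 0] with N hN
    simp [orbitAverage, hN.ne']
  have h : ∀ z : ℤ, ∑ j, k j * α j ≠ z := fun z hz => hk (hα k z hz)
  rw [integral_mFourier_eq_zero h]
  have h1 := mFourier_coe_ne_one h
  set w := UnitAddTorus.mFourier k (fun j => (α j : UnitAddCircle)) with hw
  have hn : ∀ x, ‖UnitAddTorus.mFourier k x‖ ≤ 1 := fun x =>
    (ContinuousMap.norm_coe_le_norm _ x).trans_eq UnitAddTorus.mFourier_norm
  -- The orbit sum is a geometric sum of ratio `w ≠ 1`, hence bounded by `2 / ‖w - 1‖` uniformly in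
  -- `N`.
  refine squeeze_zero_norm' (a := fun N : ℕ => (2 / ‖w - 1‖) / N) ?_
    (tendsto_const_div_atTop_nhds_zero_nat _)
  filter_upwards with N
  simp only [orbitAverage, rotationOrbit_eq, mFourier_add_apply, mFourier_nsmul_apply, ← hw]
  rw [← Finset.sum_mul, geom_sum_eq h1, norm_mul, norm_mul, norm_div, norm_inv, Complex.norm_natCast]
  have h2 : ‖w ^ N - 1‖ ≤ 2 := by
    refine (norm_sub_le _ _).trans ?_
    rw [norm_pow, norm_one]
    have := pow_le_one₀ (n := N) (norm_nonneg w) (hn _)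
    linarith
  rw [div_eq_inv_mul (_ / _)]
  gcongr
  calc _ ≤ 2 / ‖w - 1‖ * 1 := by gcongr; exact hn _
    _ = _ := mul_one _

/-- **Weyl's equidistribution theorem** for continuous functions. -/
theorem tendsto_orbitAverage {α : κ → ℝ} (β : κ → ℝ)
    (hα : ∀ k : κ → ℤ, ∀ z : ℤ, ∑ j, k j * α j = z → k = 0) (f : C(κ → UnitAddCircle, ℂ)) :
    Tendsto (orbitAverage α β f) atTop (𝓝 (∫ x, f x)) := by
  have hint : ∀ g : C(κ → UnitAddCircle, ℂ), Integrable g := fun g =>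
    g.continuous.integrable_of_hasCompactSupport (HasCompactSupport.of_compactSpace _)
  have hspan : ∀ g ∈ Submodule.span ℂ (Set.range (UnitAddTorus.mFourier (d := κ))),
      Tendsto (orbitAverage α β g) atTop (𝓝 (∫ x, g x)) := by
    intro g hg
    induction hg using Submodule.span_induction with
    | mem g hg =>
      obtain ⟨k, rfl⟩ := hg
      exact tendsto_orbitAverage_mFourier β hα k
    | zero =>
      refine (tendsto_const_nhds (x := (0 : ℂ))).congr' (Eventually.of_forall fun N => ?_) |>.trans ?_
      · simp [orbitAverage]
      · simp
    | add g h _ _ hg hh =>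
      have : ∫ x, (g + h) x = (∫ x, g x) + ∫ x, h x := integral_add (hint g) (hint h)
      rw [this]
      exact (hg.add hh).congr fun N => (orbitAverage_add ..).symm
    | smul c g _ hg =>
      have : ∫ x, (c • g) x = c * ∫ x, g x := integral_const_mul c _
      rw [this]
      exact (hg.const_mul c).congr fun N => (orbitAverage_const_mul ..).symm
  rw [Metric.tendsto_atTop]
  intro ε hε
  have hf : f ∈ closure (Submodule.span ℂ (Set.range (UnitAddTorus.mFourier (d := κ))) :
      Set C(κ → UnitAddCircle, ℂ)) := by
    rw [← Submodule.topologicalClosure_coe, UnitAddTorus.span_mFourier_closure_eq_top]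
    trivial
  obtain ⟨g, hg, hfg⟩ := Metric.mem_closure_iff.1 hf (ε / 3) (by positivity)
  obtain ⟨N₀, hN₀⟩ := Metric.tendsto_atTop.1 (hspan g hg) (ε / 3) (by positivity)
  refine ⟨N₀, fun N hN => ?_⟩
  have h1 : ∀ x, ‖f x - g x‖ ≤ ε / 3 := fun x => by
    rw [← dist_eq_norm]; exact (ContinuousMap.dist_apply_le_dist x).trans hfg.le
  have h2 : ‖orbitAverage α β f N - orbitAverage α β g N‖ ≤ ε / 3 := by
    have := norm_orbitAverage_le α β (by positivity) h1 N
    have e := orbitAverage_add α β (fun x => f x - g x) g N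
    simp only [sub_add_cancel] at e
    rw [show orbitAverage α β f N = _ from e, add_sub_cancel_right]
    exact this
  have h3 : ‖(∫ x, f x) - ∫ x, g x‖ ≤ ε / 3 := by
    rw [← integral_sub (hint f) (hint g)]
    exact (norm_integral_le_of_norm_le_const (ae_of_all _ h1)).trans_eq (by simp)
  have h4 := hN₀ N hN
  rw [dist_eq_norm] at h4 ⊢
  calc _ = ‖(orbitAverage α β f N - orbitAverage α β g N) +
        (orbitAverage α β g N - ∫ x, g x) - ((∫ x, f x) - ∫ x, g x)‖ := by congr 1; ring
    _ ≤ ‖orbitAverage α β f N - orbitAverage α β g N‖ +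
        ‖orbitAverage α β g N - ∫ x, g x‖ + ‖(∫ x, f x) - ∫ x, g x‖ :=
      (norm_sub_le _ _).trans (add_le_add_left (norm_add_le _ _) _)
    _ < ε := by linarith

/-- The empirical measure of the first `N + 1` points of an orbit. -/
noncomputable def empiricalMeasure (α β : κ → ℝ) (N : ℕ) :
    ProbabilityMeasure (κ → UnitAddCircle) :=
  ⟨((N + 1 : ℕ) : ENNReal)⁻¹ • ∑ l ∈ Finset.range (N + 1), Measure.dirac (rotationOrbit α β l), ⟨by
    simp [ENNReal.inv_mul_cancel]⟩⟩

theorem tendsto_empiricalMeasure {α : κ → ℝ} (β : κ → ℝ)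
    (hα : ∀ k : κ → ℤ, ∀ z : ℤ, ∑ j, k j * α j = z → k = 0) :
    Tendsto (empiricalMeasure α β) atTop (𝓝 (⟨volume, inferInstance⟩ :
      ProbabilityMeasure (κ → UnitAddCircle))) := by
  refine ProbabilityMeasure.tendsto_iff_forall_integral_tendsto.2 fun f => ?_
  have h := (tendsto_orbitAverage β hα ⟨fun x => (f x : ℂ), by fun_prop⟩).comp
    (tendsto_add_atTop_nat 1)
  have h' := (Complex.continuous_re.tendsto _).comp h
  simp only [ContinuousMap.coe_mk, integral_complex_ofReal, Complex.ofReal_re] at h'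
  refine h'.congr fun N => ?_
  simp only [Function.comp, orbitAverage, empiricalMeasure, ProbabilityMeasure.coe_mk,
    integral_smul_measure]
  rw [integral_finsetSum_measure fun l _ => integrable_dirac (by simp)]
  simp only [integral_dirac]
  rw [← Complex.ofReal_sum, ← Complex.ofReal_natCast, ← Complex.ofReal_inv, ← Complex.ofReal_mul,
    Complex.ofReal_re, ENNReal.toReal_inv, ENNReal.toReal_natCast, smul_eq_mul]

end Weyl

/-! ### Equidistribution in boxes -/

/-- The arc of the circle which is the image of the interval `[a, b)`. -/
def arc (a b : ℝ) : Set UnitAddCircle := ((↑) : ℝ → UnitAddCircle) '' Set.Ico a b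

theorem coe_mem_arc {a b : ℝ} (ha : 0 ≤ a) (hb : b ≤ 1) (x : ℝ) :
    (x : UnitAddCircle) ∈ arc a b ↔ Int.fract x ∈ Set.Ico a b := by
  constructor
  · rintro ⟨y, hy, hxy⟩
    have h := congrArg (fun t => ((AddCircle.equivIco (1 : ℝ) 0 t : Set.Ico (0 : ℝ) (0 + 1)) : ℝ)) hxy
    simp only [AddCircle.coe_equivIco_mk_apply, div_one, mul_one] at h
    rw [← h, Int.fract_eq_self.2 ⟨ha.trans hy.1, hy.2.trans_le hb⟩]
    exact hy
  · intro h
    refine ⟨Int.fract x, h, ?_⟩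
    rw [← sub_eq_zero, ← AddCircle.coe_sub, AddCircle.coe_eq_zero_iff]
    exact ⟨-⌊x⌋, by rw [← Int.self_sub_floor]; simp⟩

/-- The quotient map is open and `[a, b]` is compact, so the arc lies between the open image of `(a,
b)` and the closed image of `[a, b]`. Boxes of arcs thus have null frontier, as the portmanteau
theorem requires. -/
theorem frontier_arc_subset (a b : ℝ) :
    frontier (arc a b) ⊆ {(a : UnitAddCircle), (b : UnitAddCircle)} := by
  have h1 : closure (arc a b) ⊆ ((↑) : ℝ → UnitAddCircle) '' Set.Icc a b :=
    closure_minimal (Set.image_mono Set.Ico_subset_Icc_self)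
      (isCompact_Icc.image (AddCircle.continuous_mk' 1)).isClosed
  have h2 : ((↑) : ℝ → UnitAddCircle) '' Set.Ioo a b ⊆ interior (arc a b) :=
    interior_maximal (Set.image_mono Set.Ioo_subset_Ico_self)
      (QuotientAddGroup.isOpenMap_coe _ isOpen_Ioo)
  rintro x ⟨hx1, hx2⟩
  obtain ⟨y, hy, rfl⟩ := h1 hx1
  rcases eq_or_ne y a with rfl | hya
  · simp
  rcases eq_or_ne y b with rfl | hyb
  · simp
  exact absurd (h2 ⟨y, ⟨lt_of_le_of_ne hy.1 hya.symm, lt_of_le_of_ne hy.2 hyb⟩, rfl⟩) hx2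

theorem volume_frontier_arc (a b : ℝ) : volume (frontier (arc a b)) = 0 := by
  have h : ∀ x : UnitAddCircle, volume {x} = 0 := fun x => by
    rw [← Metric.closedBall_zero, AddCircle.volume_closedBall]
    simp
  exact measure_mono_null (frontier_arc_subset a b) (measure_union_null (h _) (h _))

theorem measurableSet_arc (a b : ℝ) : MeasurableSet (arc a b) := by
  rcases lt_or_ge a b with h | h
  · rw [arc, ← Set.Ioo_union_left h, Set.image_union, Set.image_singleton]
    exact (QuotientAddGroup.isOpenMap_coe _ isOpen_Ioo).measurableSet.union
      (measurableSet_singleton _)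
  · simp [arc, Set.Ico_eq_empty_of_le h]

theorem volume_arc {a b : ℝ} (ha : 0 ≤ a) (hb : b ≤ 1) :
    volume (arc a b) = ENNReal.ofReal (b - a) := by
  rw [← (UnitAddCircle.measurePreserving_mk 0).measure_preimage
    (measurableSet_arc a b).nullMeasurableSet, ← Real.volume_Ico,
    Measure.restrict_apply ((measurableSet_arc a b).preimage (AddCircle.measurable_mk'))]
  refine measure_congr ?_
  -- The measure on the circle comes from `(0, 1]`, while `Int.fract` takes values in `[0, 1)`; the
  -- two differ only at the endpoints.
  have h0 : ∀ᵐ x : ℝ, x ≠ 0 ∧ x ≠ 1 := by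
    filter_upwards [compl_mem_ae_iff.2 ((Set.toFinite ({0, 1} : Set ℝ)).measure_zero volume)]
      with x hx
    simpa using hx
  filter_upwards [h0] with x hx
  refine propext ?_
  change ((x : UnitAddCircle) ∈ arc a b ∧ x ∈ Set.Ioc (0 : ℝ) (0 + 1)) ↔ x ∈ Set.Ico a b
  rw [coe_mem_arc ha hb, zero_add]
  constructor
  · rintro ⟨h, h1⟩
    rwa [Int.fract_eq_self.2 ⟨h1.1.le, lt_of_le_of_ne h1.2 hx.2⟩] at h
  · intro h
    rw [Int.fract_eq_self.2 ⟨ha.trans h.1, h.2.trans_le hb⟩]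
    exact ⟨h, lt_of_le_of_ne (ha.trans h.1) hx.1.symm, (h.2.trans_le hb).le⟩

section Box

variable {κ : Type*} [Fintype κ]

theorem volume_frontier_box (a b : κ → ℝ) :
    volume (frontier (Set.univ.pi fun j => arc (a j) (b j))) = 0 := by
  have h : frontier (Set.univ.pi fun j => arc (a j) (b j)) ⊆
      ⋃ j, (Function.eval j) ⁻¹' frontier (arc (a j) (b j)) := by
    rintro x ⟨hx1, hx2⟩
    rw [closure_pi_set] at hx1
    rw [interior_pi_set Set.finite_univ] at hx2
    simp only [Set.mem_pi, not_forall] at hx2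
    obtain ⟨j, hj, hxj⟩ := hx2
    exact Set.mem_iUnion.2 ⟨j, hx1 j hj, hxj⟩
  refine measure_mono_null h (measure_iUnion_null fun j => ?_)
  have := (measurePreserving_eval (fun _ : κ => (volume : Measure UnitAddCircle)) j)
  exact (this.measure_preimage isClosed_frontier.measurableSet.nullMeasurableSet).trans
    (volume_frontier_arc _ _)

open Classical in
/-- **Weyl's equidistribution theorem** for boxes. -/
theorem tendsto_frequency_box {α : κ → ℝ} (β : κ → ℝ)
    (hα : ∀ k : κ → ℤ, ∀ z : ℤ, ∑ j, k j * α j = z → k = 0) {a b : κ → ℝ}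
    (ha : ∀ j, 0 ≤ a j) (hab : ∀ j, a j ≤ b j) (hb : ∀ j, b j ≤ 1) :
    Tendsto (fun N : ℕ => (N : ℝ)⁻¹ * ∑ l ∈ Finset.range N,
      if ∀ j, Int.fract (l * α j + β j) ∈ Set.Ico (a j) (b j) then (1 : ℝ) else 0) atTop
      (𝓝 (∏ j, (b j - a j))) := by
  have h := ProbabilityMeasure.tendsto_measure_of_null_frontier_of_tendsto'
    (tendsto_empiricalMeasure β hα) (volume_frontier_box a b)
  have hv : (volume : Measure (κ → UnitAddCircle)) (Set.univ.pi fun j => arc (a j) (b j)) =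
      ∏ j, ENNReal.ofReal (b j - a j) := by
    rw [volume_pi_pi]
    exact Finset.prod_congr rfl fun j _ => volume_arc (ha j) (hb j)
  simp only [ProbabilityMeasure.coe_mk, hv] at h
  have h' := (ENNReal.tendsto_toReal (ENNReal.prod_ne_top fun j _ => ENNReal.ofReal_ne_top)).comp h
  rw [ENNReal.toReal_prod] at h'
  simp only [ENNReal.toReal_ofReal (sub_nonneg.2 (hab _))] at h'
  refine (tendsto_add_atTop_iff_nat 1).1 (h'.congr fun N => ?_)
  have hm : MeasurableSet (Set.univ.pi fun j => arc (a j) (b j)) :=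
    MeasurableSet.univ_pi fun j => measurableSet_arc _ _
  simp only [Function.comp, empiricalMeasure, ProbabilityMeasure.coe_mk, Measure.smul_apply,
    Measure.finsetSum_apply, Measure.dirac_apply' _ hm, smul_eq_mul, ENNReal.toReal_mul]
  rw [ENNReal.toReal_sum (fun l _ => by simp [Set.indicator_apply]; split_ifs <;> simp)]
  congr 1
  · rw [ENNReal.toReal_inv, ENNReal.toReal_natCast]
  · refine Finset.sum_congr rfl fun l _ => ?_
    simp only [Set.indicator_apply, Set.mem_univ_pi, rotationOrbit, coe_mem_arc (ha _) (hb _)]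
    split_ifs <;> simp

end Box

/-! ### Averages along residue classes -/

/-- The range splits into `N / m` full blocks of length `m` and a remainder, which contributes at
most `m * C / N`. -/
theorem tendsto_average_of_residues {m : ℕ} (hm : 0 < m) {f : ℕ → ℝ} {C : ℝ}
    (hf : ∀ n, |f n| ≤ C) {c : ℕ → ℝ}
    (h : ∀ r < m, Tendsto (fun N : ℕ => (N : ℝ)⁻¹ * ∑ l ∈ Finset.range N, f (l * m + r)) atTop
      (𝓝 (c r))) :
    Tendsto (fun N : ℕ => (N : ℝ)⁻¹ * ∑ n ∈ Finset.range N, f n) atTop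
      (𝓝 ((m : ℝ)⁻¹ * ∑ r ∈ Finset.range m, c r)) := by
  have hmul : ∀ L : ℕ, ∑ n ∈ Finset.range (L * m), f n =
      ∑ r ∈ Finset.range m, ∑ l ∈ Finset.range L, f (l * m + r) := by
    intro L
    rw [Finset.sum_comm]
    induction L with
    | zero => simp
    | succ L ih => rw [Finset.sum_range_succ, ← ih, add_mul, one_mul, Finset.sum_range_add]
  have hdiv : Tendsto (fun N : ℕ => N / m) atTop atTop := Nat.tendsto_div_const_atTop hm.ne'
  have hratio : Tendsto (fun N : ℕ => (N : ℝ)⁻¹ * ((N / m : ℕ) : ℝ)) atTop (𝓝 (m : ℝ)⁻¹) := by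
    have := (tendsto_nat_floor_mul_div_atTop (R := ℝ) (a := (m : ℝ)⁻¹) (by positivity)).comp
      (tendsto_natCast_atTop_atTop (R := ℝ))
    refine this.congr fun N => ?_
    simp only [Function.comp]
    rw [← div_eq_inv_mul, ← div_eq_inv_mul, Nat.floor_div_eq_div]
  have hsum : Tendsto (fun L : ℕ => (L : ℝ)⁻¹ * ∑ n ∈ Finset.range (L * m), f n) atTop
      (𝓝 (∑ r ∈ Finset.range m, c r)) := by
    refine (tendsto_finsetSum _ fun r hr => h r (Finset.mem_range.1 hr)).congr fun L => ?_
    rw [hmul, Finset.mul_sum]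
  have hmain := hratio.mul (hsum.comp hdiv)
  have hrest : Tendsto (fun N : ℕ => (N : ℝ)⁻¹ * ∑ r ∈ Finset.range (N % m), f (N / m * m + r))
      atTop (𝓝 0) := by
    refine squeeze_zero_norm (a := fun N : ℕ => (m * C) / N) (fun N => ?_)
      (tendsto_const_div_atTop_nhds_zero_nat _)
    rw [norm_mul, norm_inv, Real.norm_natCast, ← div_eq_inv_mul]
    gcongr
    have hC : 0 ≤ C := (abs_nonneg _).trans (hf 0)
    calc _ ≤ ∑ r ∈ Finset.range (N % m), C := norm_sum_le_of_le _ fun r _ => hf _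
      _ = (N % m : ℕ) * C := by simp
      _ ≤ m * C := by
        gcongr
        exact (Nat.mod_lt _ hm).le
  refine ((hmain.add hrest).congr' ?_).trans (by simp)
  filter_upwards [eventually_ge_atTop m] with N hN
  have hL : ((N / m : ℕ) : ℝ) ≠ 0 := by
    have := Nat.div_pos hN hm
    exact_mod_cast this.ne'
  simp only [Function.comp]
  rw [mul_assoc, mul_inv_cancel_left₀ hL, ← mul_add, ← Finset.sum_range_add, Nat.div_add_mod']

/-! ### Floors of multiples -/

/-- If `R = ⌊x⌋ % m`, then `Int.fract (x / m) = (R + Int.fract x) / m`: a single point of the circle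
records both the residue of the floor and the position inside the unit interval. -/
theorem fract_div_mem_Ico_iff {m c : ℕ} (hc : c < m) {a b : ℝ} (ha : 0 ≤ a) (hb : b ≤ 1) (x : ℝ) :
    Int.fract (x / m) ∈ Set.Ico ((c + a) / m) ((c + b) / m) ↔
      ⌊x⌋ % m = c ∧ Int.fract x ∈ Set.Ico a b := by
  have hm : (0 : ℝ) < m := by exact_mod_cast (Nat.zero_le c).trans_lt hc
  have hmz : (0 : ℤ) < m := by exact_mod_cast hm
  have hR0 := Int.emod_nonneg ⌊x⌋ hmz.ne'
  have hR1 := Int.emod_lt_of_pos ⌊x⌋ hmz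
  have hdm := Int.emod_add_mul_ediv ⌊x⌋ m
  set R := ⌊x⌋ % (m : ℤ)
  have hf0 := Int.fract_nonneg x
  have hf1 := Int.fract_lt_one x
  have hx : x / m = (⌊x⌋ / (m : ℤ) : ℤ) + (R + Int.fract x) / m := by
    have : (⌊x⌋ : ℝ) = R + m * (⌊x⌋ / (m : ℤ) : ℤ) := by exact_mod_cast hdm.symm
    field_simp
    linarith [Int.floor_add_fract x]
  have hR1' : (R : ℝ) + 1 ≤ m := by exact_mod_cast hR1
  have hR0' : (0 : ℝ) ≤ R := by exact_mod_cast hR0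
  have hfr : Int.fract (x / m) = (R + Int.fract x) / m := by
    rw [hx, Int.fract_intCast_add, Int.fract_eq_self]
    refine ⟨by positivity, ?_⟩
    rw [div_lt_one hm]
    linarith
  rw [hfr, Set.mem_Ico, Set.mem_Ico, div_le_div_iff_of_pos_right hm, div_lt_div_iff_of_pos_right hm]
  constructor
  · rintro ⟨h1, h2⟩
    have h3 : (R : ℝ) < c + 1 := by linarith
    have h4 : (c : ℝ) < R + 1 := by linarith
    have h5 : R = c := by
      have h3' : R < c + 1 := by exact_mod_cast h3
      have h4' : (c : ℤ) < R + 1 := by exact_mod_cast h4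
      omega
    have h6 : (R : ℝ) = c := by exact_mod_cast h5
    exact ⟨h5, by linarith, by linarith⟩
  · rintro ⟨h1, h2, h3⟩
    have h6 : (R : ℝ) = c := by exact_mod_cast h1
    exact ⟨by linarith, by linarith⟩

theorem floor_add_of_pos {d : ℝ} (h0 : 0 < d) (h1 : d < 1) (x : ℝ) :
    ⌊x + d⌋ = ⌊x⌋ + if 1 - d ≤ Int.fract x then 1 else 0 := by
  have := Int.fract_nonneg x
  have := Int.fract_lt_one x
  have := Int.floor_add_fract x
  rw [Int.floor_eq_iff]
  split_ifs <;> push_cast <;> constructor <;> linarith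

theorem floor_add_of_neg {d : ℝ} (h0 : d < 0) (h1 : -1 < d) (x : ℝ) :
    ⌊x + d⌋ = ⌊x⌋ + if Int.fract x < -d then -1 else 0 := by
  have := Int.fract_nonneg x
  have := Int.fract_lt_one x
  have := Int.floor_add_fract x
  rw [Int.floor_eq_iff]
  split_ifs <;> push_cast <;> constructor <;> linarith

theorem floor_add_eq {d : ℝ} (h0 : d ≠ 0) (h1 : |d| < 1) (x : ℝ) :
    ⌊x + d⌋ = ⌊x⌋ + if ⌊x + d⌋ ≠ ⌊x⌋ then (if 0 < d then 1 else -1) else 0 := by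
  rw [abs_lt] at h1
  rcases lt_or_gt_of_ne h0 with h | h
  · rw [floor_add_of_neg h h1.1, if_neg h.not_gt]
    split_ifs <;> simp_all
  · rw [floor_add_of_pos h h1.2, if_pos h]
    split_ifs <;> simp_all

open Classical in
-- The floor changes on an end piece of `[0, 1)` of length `|d|`: the right end if `d > 0`, the left
-- end if `d < 0`. Both this event and its complement are therefore half-open intervals, suitable as
-- sides of a box.
theorem exists_Ico_floor_add_ne_iff {d : ℝ} (h0 : d ≠ 0) (h1 : |d| < 1) (B : Prop) :
    ∃ a b : ℝ, 0 ≤ a ∧ a ≤ b ∧ b ≤ 1 ∧ b - a = (if B then |d| else 1 - |d|) ∧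
      ∀ x : ℝ, Int.fract x ∈ Set.Ico a b ↔ (⌊x + d⌋ ≠ ⌊x⌋ ↔ B) := by
  have hd := abs_lt.1 h1
  rcases lt_or_gt_of_ne h0 with h | h
  · have key : ∀ x : ℝ, ⌊x + d⌋ ≠ ⌊x⌋ ↔ Int.fract x < -d := fun x => by
      rw [floor_add_of_neg h hd.1]
      split_ifs <;> simp_all
    by_cases hB : B
    · refine ⟨0, -d, le_rfl, by linarith, by linarith, by simp [hB, abs_of_neg h], fun x => ?_⟩
      simp [key, hB, Int.fract_nonneg]
    · refine ⟨-d, 1, by linarith, by linarith, le_rfl, by simp [hB, abs_of_neg h], fun x => ?_⟩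
      simp [key, hB, Int.fract_lt_one]
  · have key : ∀ x : ℝ, ⌊x + d⌋ ≠ ⌊x⌋ ↔ 1 - d ≤ Int.fract x := fun x => by
      rw [floor_add_of_pos h hd.2]
      split_ifs <;> simp_all
    by_cases hB : B
    · refine ⟨1 - d, 1, by linarith, by linarith, le_rfl, by simp [hB, abs_of_pos h], fun x => ?_⟩
      rw [key]
      simp [hB, Int.fract_lt_one]
    · refine ⟨0, 1 - d, le_rfl, by linarith, by linarith, by simp [hB, abs_of_pos h], fun x => ?_⟩
      rw [key]
      simp only [hB, iff_false, not_le, Set.mem_Ico, Int.fract_nonneg, true_and]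

/-! ### Frequency of descents of the quotient -/

section Descent

variable {κ : Type*} [Fintype κ]

open Classical in
/-- The probability that, for independent `I j` with law `Be(r j)`, the set of `j` with `I j = 1`
is `T`. -/
noncomputable def patternWeight (r : κ → ℝ) (T : Finset κ) : ℝ :=
  ∏ j, if j ∈ T then r j else 1 - r j

/-- `n` minus the sum of the integer parts of `n d_j`. -/
noncomputable def floorDefect (d : κ → ℝ) (n : ℕ) : ℤ := n - ∑ j, ⌊(n : ℝ) * d j⌋

open Classical in
/-- The drop of `floorDefect d` at a step where the integer parts of `n d_j` that change are those
with `j ∈ T`. -/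
noncomputable def defectDrop (d : κ → ℝ) (T : Finset κ) : ℤ :=
  ((T.filter fun j => 0 < d j).card : ℤ) - (T.filter fun j => d j < 0).card - 1

open Classical in
/-- The set of `j` for which the integer part of `n d_j` changes at the next step. -/
noncomputable def changeSet (d : κ → ℝ) (n : ℕ) : Finset κ :=
  Finset.univ.filter fun j => ⌊(n : ℝ) * d j + d j⌋ ≠ ⌊(n : ℝ) * d j⌋

theorem floorDefect_succ {d : κ → ℝ} (h0 : ∀ j, d j ≠ 0) (h1 : ∀ j, |d j| < 1) (n : ℕ) :
    floorDefect d (n + 1) = floorDefect d n - defectDrop d (changeSet d n) := by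
  classical
  have h : ∀ j, ⌊((n + 1 : ℕ) : ℝ) * d j⌋ = ⌊(n : ℝ) * d j⌋ +
      if j ∈ changeSet d n then (if 0 < d j then 1 else -1) else 0 := fun j => by
    rw [Nat.cast_add_one, add_one_mul, floor_add_eq (h0 j) (h1 j)]
    simp [changeSet]
  simp only [floorDefect, h, Finset.sum_add_distrib, defectDrop]
  rw [Finset.sum_ite_mem, Finset.univ_inter, Finset.sum_ite]
  have h2 : (changeSet d n).filter (fun j => ¬ 0 < d j) =
      (changeSet d n).filter fun j => d j < 0 :=
    Finset.filter_congr fun j _ => by rw [not_lt]; exact ⟨fun h => lt_of_le_of_ne h (h0 j), le_of_lt⟩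
  rw [h2]
  simp
  ring

theorem defectDrop_le (d : κ → ℝ) {m : ℕ} (hm : Fintype.card κ < m) (T : Finset κ) :
    defectDrop d T ≤ m := by
  classical
  have h := (Finset.card_filter_le T fun j => 0 < d j).trans (Finset.card_le_univ T)
  rw [defectDrop]
  omega

theorem ediv_sub_lt_ediv_iff {m : ℤ} (hm : 0 < m) (a h : ℤ) : (a - h) / m < a / m ↔ a % m < h := by
  have h1 := Int.emod_add_mul_ediv a m
  rw [Int.ediv_lt_iff_lt_mul hm, mul_comm]
  omega

/-- Translation by `c` permutes the residues, and `h ≤ m` ensures that exactly `h₊` of `0, …, m - 1`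
lie below `h`. -/
theorem sum_val_lt {m : ℕ} [NeZero m] {h : ℤ} (hle : h ≤ m) (c : ZMod m) :
    ∑ r ∈ Finset.range m, (if ((((r : ZMod m) - c).val : ℤ) < h) then (1 : ℝ) else 0) =
      max (h : ℝ) 0 := by
  have h1 : ∑ r ∈ Finset.range m, (if ((((r : ZMod m) - c).val : ℤ) < h) then (1 : ℝ) else 0) =
      ∑ x : ZMod m, if ((x - c).val : ℤ) < h then (1 : ℝ) else 0 := by
    refine Finset.sum_nbij' (fun r => (r : ZMod m)) (fun x => x.val) ?_ ?_ ?_ ?_ ?_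
    · simp
    · intro x _; simpa using ZMod.val_lt x
    · intro r hr; exact ZMod.val_cast_of_lt (Finset.mem_range.1 hr)
    · simp
    · simp
  have h2 : ∑ x : ZMod m, (if ((x - c).val : ℤ) < h then (1 : ℝ) else 0) =
      ∑ x : ZMod m, if (x.val : ℤ) < h then (1 : ℝ) else 0 :=
    Fintype.sum_equiv (Equiv.subRight c) _ _ fun x => rfl
  have h3 : ∑ x : ZMod m, (if (x.val : ℤ) < h then (1 : ℝ) else 0) =
      ∑ r ∈ Finset.range m, if (r : ℤ) < h then (1 : ℝ) else 0 := by
    refine Finset.sum_nbij' (fun x => x.val) (fun r => (r : ZMod m)) ?_ ?_ ?_ ?_ ?_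
    · intro x _; simpa using ZMod.val_lt x
    · simp
    · simp
    · intro r hr; exact ZMod.val_cast_of_lt (Finset.mem_range.1 hr)
    · simp
  have h4 : (Finset.range m).filter (fun r : ℕ => (r : ℤ) < h) = Finset.range h.toNat := by
    ext r
    simp
    omega
  rw [h1, h2, h3, Finset.sum_boole, h4, Finset.card_range, ← Int.cast_natCast, Int.toNat_eq_max]
  simp

theorem val_floorDefect {d : κ → ℝ} {m : ℕ} [NeZero m] (n : ℕ) :
    ((((n : ZMod m) - ∑ j, ((⌊(n : ℝ) * d j⌋ : ℤ) : ZMod m)).val : ℕ) : ℤ) =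
      floorDefect d n % m := by
  rw [← ZMod.val_intCast, floorDefect]
  push_cast
  rfl

open Classical in
theorem tendsto_frequency_descent {d : κ → ℝ} (h0 : ∀ j, d j ≠ 0) (h1 : ∀ j, |d j| < 1)
    (hd : ∀ k : κ → ℤ, ∀ z : ℤ, ∑ j, k j * d j = z → k = 0) {m : ℕ} (hm : Fintype.card κ < m) :
    Tendsto (fun N : ℕ => (N : ℝ)⁻¹ * ∑ n ∈ Finset.range N,
        if floorDefect d (n + 1) / m < floorDefect d n / m then (1 : ℝ) else 0) atTop
      (𝓝 ((m : ℝ)⁻¹ * ∑ T : Finset κ,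
        patternWeight (fun j => |d j|) T * max (defectDrop d T : ℝ) 0)) := by
  have hm0 : 0 < m := (Nat.zero_le _).trans_lt hm
  have : NeZero m := ⟨hm0.ne'⟩
  have hmr : (0 : ℝ) < m := by exact_mod_cast hm0
  choose a b ha hab hb hlen hmem using fun (T : Finset κ) (j : κ) =>
    exists_Ico_floor_add_ne_iff (h0 j) (h1 j) (j ∈ T)
  set P : ℕ → (κ → ZMod m) → Finset κ → Prop := fun r c T =>
    ((((r : ZMod m) - ∑ j, c j).val : ℕ) : ℤ) < defectDrop d T with hP
  -- For `n = l * m + r` one has `n * d j / m = l * d j + r * d j / m`, a rotation by `d j` itself.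
  -- The box prescribes the residues `c` of the floors and the set `T` of floors about to change.
  set box : ℕ → (κ → ZMod m) → Finset κ → ℕ → Prop := fun r c T l =>
    ∀ j, Int.fract (l * d j + r * d j / m) ∈
      Set.Ico (((c j).val + a T j) / m) (((c j).val + b T j) / m) with hbox
  have hbox_iff : ∀ r c T l, box r c T l ↔
      c = (fun j => ((⌊((l * m + r : ℕ) : ℝ) * d j⌋ : ℤ) : ZMod m)) ∧
        T = changeSet d (l * m + r) := by
    intro r c T l
    have hx : ∀ j, (l * d j + r * d j / m : ℝ) = ((l * m + r : ℕ) : ℝ) * d j / m := fun j => by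
      push_cast
      field_simp
    simp only [hbox, hx, fract_div_mem_Ico_iff (ZMod.val_lt _) (ha T _) (hb T _), hmem,
      forall_and, funext_iff, Finset.ext_iff, changeSet, Finset.mem_filter, Finset.mem_univ,
      true_and]
    refine and_congr (forall_congr' fun j => ?_) (forall_congr' fun j => iff_comm)
    rw [← ZMod.val_intCast]
    constructor
    · intro h
      exact (ZMod.val_injective m (by exact_mod_cast h)).symm
    · intro h
      rw [h]
  -- Each `l` lies in the box of exactly one pair `(c, T)`, and that pair together with `r` decides
  -- whether the quotient drops.
  have hterm : ∀ r l, (if floorDefect d (l * m + r + 1) / m < floorDefect d (l * m + r) / m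
      then (1 : ℝ) else 0) =
      ∑ c, ∑ T, (if P r c T then (1 : ℝ) else 0) * (if box r c T l then 1 else 0) := by
    intro r l
    simp only [hbox_iff, ite_and]
    rw [Finset.sum_eq_single (fun j => ((⌊((l * m + r : ℕ) : ℝ) * d j⌋ : ℤ) : ZMod m)),
      Finset.sum_eq_single (changeSet d (l * m + r))]
    · rw [if_pos rfl, if_pos rfl, mul_one, floorDefect_succ h0 h1]
      refine if_congr ?_ rfl rfl
      rw [ediv_sub_lt_ediv_iff (by exact_mod_cast hm0), hP, ← val_floorDefect]
      simp
    · intro T _ hT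
      simp [hT]
    · simp
    · intro c _ hc
      simp only [hc, if_false, mul_zero, Finset.sum_const_zero]
    · simp
  have hlim : ∀ r < m, Tendsto (fun N : ℕ => (N : ℝ)⁻¹ * ∑ l ∈ Finset.range N,
      if floorDefect d (l * m + r + 1) / m < floorDefect d (l * m + r) / m
        then (1 : ℝ) else 0) atTop
      (𝓝 (∑ c : κ → ZMod m, ∑ T : Finset κ, (if P r c T then (1 : ℝ) else 0) *
        (patternWeight (fun j => |d j|) T / m ^ Fintype.card κ))) := by
    intro r _
    have hb' : ∀ c T, Tendsto (fun N : ℕ => (N : ℝ)⁻¹ * ∑ l ∈ Finset.range N,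
        if box r c T l then (1 : ℝ) else 0) atTop
        (𝓝 (patternWeight (fun j => |d j|) T / m ^ Fintype.card κ)) := by
      intro c T
      have hlt : ∀ j, ((c j).val : ℝ) + 1 ≤ m := fun j => by exact_mod_cast ZMod.val_lt (c j)
      have := tendsto_frequency_box (fun j => r * d j / m) hd
        (a := fun j => ((c j).val + a T j) / m) (b := fun j => ((c j).val + b T j) / m)
        (fun j => div_nonneg (add_nonneg (Nat.cast_nonneg _) (ha T j)) hmr.le)
        (fun j => by have := hab T j; gcongr)
        (fun j => by rw [div_le_one hmr]; linarith [hlt j, hb T j])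
      convert this using 2
      rw [patternWeight, ← Finset.card_univ, ← Finset.prod_const, ← Finset.prod_div_distrib]
      refine Finset.prod_congr rfl fun j _ => ?_
      rw [← sub_div, add_sub_add_left_eq_sub, hlen]
      congr
    refine (tendsto_finsetSum _ fun c _ => tendsto_finsetSum _ fun T _ =>
      (hb' c T).const_mul (if P r c T then (1 : ℝ) else 0)).congr fun N => ?_
    simp only [hterm]
    rw [Finset.sum_comm (s := Finset.range N), Finset.mul_sum]
    refine Finset.sum_congr rfl fun c _ => ?_
    rw [Finset.sum_comm (s := Finset.range N), Finset.mul_sum]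
    refine Finset.sum_congr rfl fun T _ => ?_
    rw [← Finset.mul_sum, mul_left_comm]
  have hmain := tendsto_average_of_residues hm0
    (f := fun n => if floorDefect d (n + 1) / m < floorDefect d n / m then (1 : ℝ) else 0) (C := 1)
    (fun n => by split_ifs <;> simp) hlim
  convert hmain using 3
  -- Summing over `r` first, with `c` and `T` fixed, gives `h₊` whatever `c` is; the `m ^ card κ`
  -- choices of `c` then cancel the denominator.
  rw [Finset.sum_comm]
  simp_rw [Finset.sum_comm (s := Finset.range m), ← Finset.sum_mul]
  simp only [hP, sum_val_lt (defectDrop_le d hm _)]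
  rw [Finset.sum_const, Finset.card_univ, Fintype.card_fun, ZMod.card, nsmul_eq_mul, Finset.mul_sum]
  refine Finset.sum_congr rfl fun T _ => ?_
  push_cast
  field_simp

end Descent

/-! ### Hamilton's method as an integer quotient -/

section Hamilton

variable {m : ℕ} {p : Fin m → ℝ}

theorem eq_zero_of_sum_mul_sub_eq_intCast (hsum : ∑ i, p i = 1) (hlin : LinearIndependent ℚ p)
    (i : Fin m) (k : {j // j ≠ i} → ℤ) (z : ℤ) (h : ∑ j, k j * (p j - p i) = z) : k = 0 := by
  rw [Fintype.linearIndependent_iff] at hlin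
  -- Writing `z = z * ∑ p j` turns the hypothesis into a rational relation among the `p j` with
  -- these coefficients. Their vanishing gives `k j = z` and `∑ k = -z`, hence `m * z = 0`.
  set g : Fin m → ℚ := fun j => (if hj : j ≠ i then (k ⟨j, hj⟩ : ℚ) else -∑ l, (k l : ℚ)) - z
    with hg
  have hgi : g i = -∑ l, (k l : ℚ) - z := by simp [hg]
  have hgj : ∀ j : {j // j ≠ i}, g j = k j - z := fun j => by simp [hg, j.2]
  have h0 := hlin g (by
    rw [Fintype.sum_eq_add_sum_subtype_ne _ i, hgi]
    rw [Fintype.sum_eq_add_sum_subtype_ne _ i] at hsum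
    simp only [hgj, Rat.smul_def]
    push_cast
    simp only [mul_sub, sub_mul, Finset.sum_sub_distrib, ← Finset.sum_mul, ← Finset.mul_sum] at h ⊢
    linear_combination h - z * hsum)
  have h1 : ∀ j : {j // j ≠ i}, k j = z := fun j => by
    have := hgj j
    rw [h0] at this
    exact_mod_cast (sub_eq_zero.1 this.symm)
  have h2 : ∑ l, k l = -z := by
    have := hgi
    rw [h0] at this
    have h3 : (∑ l, (k l : ℚ)) = -z := by linarith
    exact_mod_cast h3
  simp only [h1, Finset.sum_const, nsmul_eq_mul] at h2
  have h4 : ((Finset.univ : Finset {j // j ≠ i}).card + 1 : ℤ) * z = 0 := by linarith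
  have h5 : z = 0 := by
    rcases mul_eq_zero.1 h4 with h | h
    · omega
    · exact h
  funext j
  rw [h1, h5, Pi.zero_apply]

theorem remainder_ne_remainder (hsum : ∑ i, p i = 1) (hlin : LinearIndependent ℚ p) {n : ℕ}
    (hn : n ≠ 0) {i j : Fin m} (hij : j ≠ i) : remainder p n j ≠ remainder p n i := by
  intro h
  obtain ⟨z, hz⟩ := Int.fract_eq_fract.1 h
  have := eq_zero_of_sum_mul_sub_eq_intCast hsum hlin i (Pi.single ⟨j, hij⟩ (n : ℤ)) z (by
    rw [Finset.sum_eq_single ⟨j, hij⟩]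
    · simp [mul_sub, hz]
    · intro l _ hl
      simp [hl]
    · simp)
  have h2 := congrFun this ⟨j, hij⟩
  simp at h2
  exact hn h2

theorem floor_mul_sub (n : ℕ) (i j : Fin m) :
    ⌊(n : ℝ) * (p j - p i)⌋ =
      ⌊(n : ℝ) * p j⌋ - ⌊(n : ℝ) * p i⌋ - if remainder p n j < remainder p n i then 1 else 0 := by
  unfold remainder
  have := Int.fract_nonneg ((n : ℝ) * p j)
  have := Int.fract_lt_one ((n : ℝ) * p j)
  have := Int.floor_add_fract ((n : ℝ) * p j)
  have := Int.fract_nonneg ((n : ℝ) * p i)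
  have := Int.fract_lt_one ((n : ℝ) * p i)
  have := Int.floor_add_fract ((n : ℝ) * p i)
  rw [Int.floor_eq_iff]
  split_ifs <;> push_cast <;> constructor <;> linarith

theorem leftover_eq_sum_remainder (hsum : ∑ i, p i = 1) (n : ℕ) :
    (leftover p n : ℝ) = ∑ j, remainder p n j := by
  simp only [leftover, remainder, ← Int.self_sub_floor, Finset.sum_sub_distrib, ← Finset.mul_sum,
    hsum]
  push_cast
  ring

theorem leftover_nonneg (hsum : ∑ i, p i = 1) (n : ℕ) : 0 ≤ leftover p n := by
  have : (0 : ℝ) ≤ leftover p n := by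
    rw [leftover_eq_sum_remainder hsum]
    exact Finset.sum_nonneg fun j _ => Int.fract_nonneg _
  exact_mod_cast this

theorem leftover_lt (hsum : ∑ i, p i = 1) (n : ℕ) (i : Fin m) : leftover p n < m := by
  have : (leftover p n : ℝ) < m := by
    rw [leftover_eq_sum_remainder hsum]
    calc ∑ j, remainder p n j < ∑ j : Fin m, (1 : ℝ) :=
          Finset.sum_lt_sum_of_nonempty ⟨i, Finset.mem_univ i⟩ fun j _ => Int.fract_lt_one _
      _ = m := by simp
  exact_mod_cast this

open Classical in
theorem card_ahead_add_card_behind (hsum : ∑ i, p i = 1) (hlin : LinearIndependent ℚ p) {n : ℕ}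
    (hn : n ≠ 0) (i : Fin m) :
    (Finset.univ.filter fun j => remainder p n j < remainder p n i).card +
      ((ahead p n i).card + 1) = m := by
  have h : insert i (ahead p n i) =
      Finset.univ.filter fun j => ¬ remainder p n j < remainder p n i := by
    ext j
    rcases eq_or_ne j i with rfl | hj
    · simp
    have := remainder_ne_remainder hsum hlin hn hj
    simp only [ahead, Finset.mem_insert, Finset.mem_filter, Finset.mem_univ, true_and, hj, this,
      false_and, or_false, false_or, not_lt]
    exact ⟨le_of_lt, fun h => lt_of_le_of_ne h this.symm⟩
  have hi : i ∉ ahead p n i := by simp [ahead]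
  rw [← Finset.card_insert_of_notMem hi, h, Finset.card_filter_add_card_filter_not,
    Finset.card_univ, Fintype.card_fin]

/-- With `L` seats left over and `b` states behind `i`, `A(n) = m ⌊n p i⌋ + L + b` and `L + b < 2 *
m`. Absence of ties gives `b = m - 1 - (ahead p n i).card`, so `L + b ≥ m` exactly when fewer than
`L` states are ahead of `i`. -/
theorem seats_eq_floorDefect_div (hsum : ∑ i, p i = 1) (hlin : LinearIndependent ℚ p) {n : ℕ}
    (hn : n ≠ 0) (i : Fin m) :
    seats p n i = floorDefect (fun j : {j // j ≠ i} => p j - p i) n / m := by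
  classical
  have hc := card_ahead_add_card_behind hsum hlin hn i
  have h0 := leftover_nonneg hsum n
  have h1 := leftover_lt hsum n i
  have hA : floorDefect (fun j : {j // j ≠ i} => p j - p i) n =
      (leftover p n + (Finset.univ.filter fun j => remainder p n j < remainder p n i).card) +
        ⌊(n : ℝ) * p i⌋ * m := by
    have h2 := Fintype.sum_eq_add_sum_subtype_ne (fun j => ⌊(n : ℝ) * (p j - p i)⌋) i
    simp only [sub_self, mul_zero, Int.floor_zero, zero_add] at h2
    rw [floorDefect, ← h2]
    simp only [floor_mul_sub, Finset.sum_sub_distrib, leftover]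
    simp
    ring
  rw [hA, Int.add_mul_ediv_right _ _ (by omega), seats, add_comm]
  congr 1
  symm
  split_ifs with h
  · rw [Int.ediv_eq_iff_of_pos (by omega)]
    omega
  · exact Int.ediv_eq_zero_of_lt (by omega) (by omega)

theorem abs_sub_lt_one (hpos : ∀ i, 0 < p i) (hsum : ∑ i, p i = 1) (i j : Fin m) :
    |p j - p i| < 1 := by
  have h : ∀ j, p j ≤ 1 := fun j =>
    (Finset.single_le_sum (fun l _ => (hpos l).le) (Finset.mem_univ j)).trans_eq hsum
  rw [abs_lt]
  constructor <;> linarith [h i, h j, hpos i, hpos j]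

theorem isParadoxProbability_sum (hpos : ∀ i, 0 < p i) (hsum : ∑ i, p i = 1)
    (hlin : LinearIndependent ℚ p) (i : Fin m) :
    IsParadoxProbability p i ((m : ℝ)⁻¹ * ∑ T : Finset {j // j ≠ i},
      patternWeight (fun j : {j // j ≠ i} => |p j - p i|) T *
        max (defectDrop (fun j : {j // j ≠ i} => p j - p i) T : ℝ) 0) := by
  classical
  have hinj := hlin.injective
  have hcard : Fintype.card {j // j ≠ i} < m := by
    have := Fintype.card_subtype_lt (p := fun j => j ≠ i) (x := i) (by simp)
    rwa [Fintype.card_fin] at this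
  have h := tendsto_frequency_descent (d := fun j : {j // j ≠ i} => p j - p i)
    (fun j => sub_ne_zero.2 (hinj.ne j.2)) (fun j => abs_sub_lt_one hpos hsum i j)
    (eq_zero_of_sum_mul_sub_eq_intCast hsum hlin i) hcard
  set F : ℕ → Prop := fun n => floorDefect (fun j : {j // j ≠ i} => p j - p i) (n + 1) / m <
    floorDefect (fun j : {j // j ≠ i} => p j - p i) n / m with hF
  -- At `n = 0` all remainders tie and the quotient formula is not available; this single term is
  -- negligible after division by `N`.
  have hcount : ∀ N : ℕ, 0 < N → ∑ n ∈ Finset.range N, (if F n then (1 : ℝ) else 0) =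
      (if F 0 then 1 else 0) + paradoxCount p i N := by
    intro N hN
    rw [Finset.range_eq_Ico, Finset.sum_eq_sum_Ico_succ_bot hN, paradoxCount,
      ← Finset.sum_boole]
    congr 1
    refine Finset.sum_congr rfl fun n hn => ?_
    have hn0 : n ≠ 0 := by have := (Finset.mem_Ico.1 hn).1; omega
    simp only [hF, seats_eq_floorDefect_div hsum hlin hn0,
      seats_eq_floorDefect_div hsum hlin n.succ_ne_zero]
  have h0 : Tendsto (fun N : ℕ => (if F 0 then (1 : ℝ) else 0) / N) atTop (𝓝 0) :=
    tendsto_const_div_atTop_nhds_zero_nat _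
  have h2 := h.sub h0
  rw [sub_zero] at h2
  refine h2.congr' ?_
  filter_upwards [eventually_gt_atTop 0] with N hN
  have := hcount N hN
  simp only [hF] at this ⊢
  rw [this, div_eq_inv_mul, div_eq_inv_mul]
  ring

end Hamilton

/-! ### Sums over patterns and expectations -/

section Pattern

variable {κ : Type*} [Fintype κ]

theorem patternWeight_eq_zero {r : κ → ℝ} {T : Finset κ} {i : κ} (hi : r i = 0) (hiT : i ∈ T) :
    patternWeight r T = 0 :=
  Finset.prod_eq_zero (Finset.mem_univ i) (by simp [hi, hiT])

/-- The index `i` succeeds with probability `0`, so patterns containing it have no weight. This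
passes from the differences with `j ≠ i` to the family indexed by all states. -/
theorem sum_patternWeight_map_subtype [DecidableEq κ] {r : κ → ℝ} {i : κ} (hi : r i = 0)
    (g : Finset κ → ℝ) :
    ∑ T : Finset {j // j ≠ i}, patternWeight (fun j : {j // j ≠ i} => r j) T *
        g (T.map (Function.Embedding.subtype _)) =
      ∑ T : Finset κ, patternWeight r T * g T := by
  refine Finset.sum_of_injOn (fun T => T.map (Function.Embedding.subtype _))
    (Finset.map_injective _).injOn (fun _ _ => Finset.mem_coe.2 (Finset.mem_univ _)) ?_ ?_
  · intro T _ hT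
    rw [patternWeight_eq_zero hi, zero_mul]
    by_contra hiT
    refine hT ⟨T.subtype (fun j => j ≠ i), by simp, ?_⟩
    beta_reduce
    rw [Finset.subtype_map, Finset.filter_true_of_mem]
    intro j hj hji
    exact hiT (hji ▸ hj)
  · intro T _
    congr 1
    rw [patternWeight, patternWeight, Fintype.prod_eq_mul_prod_subtype_ne _ i]
    simp only [hi, sub_zero]
    rw [if_neg (by simp), one_mul]
    refine Finset.prod_congr rfl fun j _ => ?_
    have : (j : κ) ∈ T.map (Function.Embedding.subtype _) ↔ j ∈ T :=
      Finset.mem_map' (Function.Embedding.subtype _)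
    simp only [this]
    congr

theorem sum_patternWeight_of_subset [DecidableEq κ] (r : κ → ℝ) (A : Finset κ) :
    ∑ T : Finset κ, patternWeight r T * (if A ⊆ T then 1 else 0) = ∏ j ∈ A, r j := by
  -- In the expansion of this product over subsets `T`, the factor `0` at the points of `A` kills
  -- every `T` that misses a point of `A`.
  have h := Finset.prod_add r (fun j => (1 - r j) * if j ∈ A then 0 else 1) Finset.univ
  have h1 : ∏ j, (r j + (1 - r j) * if j ∈ A then 0 else 1) = ∏ j ∈ A, r j := by
    rw [← Finset.prod_subset (Finset.subset_univ A)]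
    · exact Finset.prod_congr rfl fun j hj => by simp [hj]
    · intro j _ hj
      simp [hj]
  rw [h1, Finset.powerset_univ] at h
  rw [h]
  refine Finset.sum_congr rfl fun T _ => ?_
  have h2 : patternWeight r T = (∏ j ∈ T, r j) * ∏ j ∈ Finset.univ \ T, (1 - r j) := by
    rw [patternWeight, ← Finset.prod_mul_prod_compl T, ← Finset.compl_eq_univ_sdiff]
    congr 1
    · exact Finset.prod_congr rfl fun j hj => if_pos hj
    · exact Finset.prod_congr rfl fun j hj => if_neg (Finset.mem_compl.1 hj)
  rw [h2, Finset.prod_mul_distrib, mul_assoc]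
  congr 2
  split_ifs with hA
  · refine (Finset.prod_eq_one fun j hj => if_neg fun hjA => ?_).symm
    exact (Finset.mem_sdiff.1 hj).2 (hA hjA)
  · obtain ⟨j, hjA, hjT⟩ := Finset.not_subset.1 hA
    refine (Finset.prod_eq_zero (Finset.mem_sdiff.2 ⟨Finset.mem_univ j, hjT⟩) ?_).symm
    rw [if_pos hjA]

/-- For independent indicators, the factorial moments of the numbers of successes in two disjoint
sets are products of elementary symmetric polynomials. -/
theorem sum_patternWeight_choose_mul_choose [DecidableEq κ] (r : κ → ℝ) {A B : Finset κ}
    (hAB : Disjoint A B) (k s : ℕ) :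
    ∑ T : Finset κ, patternWeight r T * (((A ∩ T).card.choose k : ℝ) * ((B ∩ T).card.choose s)) =
      (A.val.map r).esymm k * (B.val.map r).esymm s := by
  -- The binomial coefficient counts the `k`-subsets of `A` contained in `T`; the probability that
  -- disjoint `U` and `V` both lie in `T` is the product over `U ∪ V`.
  have hchoose : ∀ (A T : Finset κ) (k : ℕ), ((A ∩ T).card.choose k : ℝ) =
      ∑ U ∈ A.powersetCard k, if U ⊆ T then 1 else 0 := by
    intro A T k
    rw [← Finset.card_powersetCard, Finset.sum_boole]
    congr 2
    ext U
    simp only [Finset.mem_powersetCard, Finset.mem_filter, Finset.subset_inter_iff]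
    tauto
  simp only [hchoose, Finset.esymm_map_val, Finset.sum_mul_sum]
  simp only [Finset.mul_sum]
  rw [Finset.sum_comm]
  refine Finset.sum_congr rfl fun U hU => ?_
  rw [Finset.sum_comm]
  refine Finset.sum_congr rfl fun V hV => ?_
  have hUV : Disjoint U V := Finset.disjoint_of_subset_left (Finset.mem_powersetCard.1 hU).1
    (Finset.disjoint_of_subset_right (Finset.mem_powersetCard.1 hV).1 hAB)
  rw [← Finset.prod_union hUV, ← sum_patternWeight_of_subset]
  refine Finset.sum_congr rfl fun T _ => ?_
  simp only [Finset.union_subset_iff, ite_and]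
  split_ifs <;> simp

open Classical in
/-- The expectation of a function of independent Bernoulli variables. -/
theorem integral_pattern {Ω : Type*} [MeasurableSpace Ω] {P : Measure Ω} [IsProbabilityMeasure P]
    {I : κ → Ω → ℝ} {r : κ → ℝ} (hI : iIndepFun I P) (hr : ∀ j, IsBernoulli P (I j) (r j))
    (f : (κ → ℝ) → ℝ) :
    ∫ ω, f (fun j => I j ω) ∂P =
      ∑ T : Finset κ, patternWeight r T * f (fun j => if j ∈ T then 1 else 0) := by
  set v : Finset κ → κ → ℝ := fun T j => if j ∈ T then 1 else 0 with hv
  set E : Finset κ → Set Ω := fun T => ⋂ j ∈ Finset.univ, I j ⁻¹' {v T j} with hE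
  have hlaw : ∀ T j, P.real (I j ⁻¹' {v T j}) = if j ∈ T then r j else 1 - r j := by
    intro T j
    obtain ⟨t, ht, hX⟩ := hr j
    have h := hX.measureReal_eq (p := fun x => x = v T j) (measurableSet_singleton _)
    refine h.trans ?_
    rw [bernoulliMeasure_real_apply t (s := {x | x = v T j}) (measurableSet_singleton _), ← ht]
    by_cases hj : j ∈ T <;> simp [hv, hj]
  have hPE : ∀ T, P.real (E T) = patternWeight r T := by
    intro T
    rw [Measure.real, hI.measure_inter_preimage_eq_mul _ fun _ _ => measurableSet_singleton _,
      ENNReal.toReal_prod]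
    exact Finset.prod_congr rfl fun j _ => hlaw T j
  have hnull : ∀ T, NullMeasurableSet (E T) P := fun T =>
    Finset.nullMeasurableSet_biInter _ fun j _ => by
      obtain ⟨t, -, hX⟩ := hr j
      exact hX.aemeasurable.nullMeasurableSet_preimage (measurableSet_singleton _)
  have h01 : ∀ᵐ ω ∂P, ∀ j, I j ω = 0 ∨ I j ω = 1 := by
    rw [ae_all_iff]
    intro j
    obtain ⟨t, ht, hX⟩ := hr j
    rw [hX.ae_iff (p := fun x => x = 0 ∨ x = 1) (by measurability)]
    simp [bernoulliMeasure_def, ae_add_measure_iff, Measure.ae_smul_measure]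
  -- Almost surely the variables take only the values `0` and `1`, so the integrand is a finite sum
  -- of indicators and `f` need not be measurable.
  have hsum : ∀ᵐ ω ∂P, f (fun j => I j ω) = ∑ T, (E T).indicator (fun _ => f (v T)) ω := by
    filter_upwards [h01] with ω hω
    have hIω : (fun j => I j ω) = v (Finset.univ.filter fun j => I j ω = 1) := by
      funext j
      rcases hω j with h | h <;> simp [hv, h]
    rw [Finset.sum_eq_single (Finset.univ.filter fun j => I j ω = 1), Set.indicator_of_mem, ← hIω]
    · simp only [hE, Set.mem_iInter]
      exact fun j _ => congrFun hIω j
    · intro T _ hT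
      refine Set.indicator_of_notMem (fun hω' => hT ?_) _
      ext j
      have : I j ω = v T j := Set.mem_iInter₂.1 hω' j (Finset.mem_univ j)
      by_cases hj : j ∈ T <;> simp [this, hv, hj]
    · simp
  rw [integral_congr_ae hsum, integral_finsetSum]
  · refine Finset.sum_congr rfl fun T _ => ?_
    rw [integral_indicator₀ (hnull T), setIntegral_const, hPE, smul_eq_mul]
  · intro T _
    exact (integrable_const _).indicator₀ (hnull T)

end Pattern

/-! ### The expansion of the positive part in binomial coefficients -/

/-- The sum of `u s` weighted by the binomial coefficients `b.choose s`. -/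
def binomialTransform (u : ℕ → ℝ) (b : ℕ) : ℝ := ∑ s ∈ Finset.range (b + 1), u s * b.choose s

theorem binomialTransform_eq_sum_range (u : ℕ → ℝ) {b n : ℕ} (h : b < n) :
    binomialTransform u b = ∑ s ∈ Finset.range n, u s * b.choose s := by
  refine Finset.sum_subset (Finset.range_mono h) fun s _ hs => ?_
  rw [Nat.choose_eq_zero_of_lt (by simpa using hs)]
  simp

theorem binomialTransform_zero (u : ℕ → ℝ) : binomialTransform u 0 = u 0 := by
  simp [binomialTransform]

theorem binomialTransform_add (u v : ℕ → ℝ) (b : ℕ) :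
    binomialTransform (fun s => u s + v s) b = binomialTransform u b + binomialTransform v b := by
  simp [binomialTransform, add_mul, Finset.sum_add_distrib]

/-- Pascal's rule: raising the upper index replaces `u` by `u` plus its shift. -/
theorem binomialTransform_succ (u : ℕ → ℝ) (b : ℕ) :
    binomialTransform u (b + 1) = binomialTransform (fun s => u s + u (s + 1)) b := by
  rw [binomialTransform_add, binomialTransform_eq_sum_range u (Nat.lt_succ_of_lt (Nat.lt_succ_self b)),
    binomialTransform, binomialTransform, Finset.sum_range_succ', Finset.sum_range_succ' _ (b + 1)]
  simp only [Nat.choose_succ_succ, Nat.cast_add, mul_add, Finset.sum_add_distrib]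
  simp
  ring

/-- The coefficients of the expansion of `(a - b - 1)₊` in products of binomial coefficients. -/
def positivePartCoeff (k s : ℕ) : ℝ :=
  if 2 ≤ k then (-1) ^ (s + k) * ((s + k - 2).choose s : ℝ) else 0

theorem positivePartCoeff_rec (k s : ℕ) :
    positivePartCoeff k (s + 1) +
      (positivePartCoeff (k + 1) s + positivePartCoeff (k + 1) (s + 1)) = 0 := by
  rcases k with _ | _ | k
  · simp [positivePartCoeff]
  · simp [positivePartCoeff, pow_succ]
  · have h1 : s + 1 + (k + 2) - 2 = s + k + 1 := by omega
    have h2 : s + (k + 2 + 1) - 2 = s + k + 1 := by omega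
    have h3 : s + 1 + (k + 2 + 1) - 2 = s + k + 1 + 1 := by omega
    simp only [positivePartCoeff, show 2 ≤ k + 1 + 1 by omega, show 2 ≤ k + 1 + 1 + 1 by omega,
      if_true, h1, h2, h3, Nat.choose_succ_succ (s + k + 1) s]
    push_cast
    ring

/-- Both sides are unchanged under `(a, b) ↦ (a + 1, b + 1)`: on the left this is Pascal's rule in
each variable combined with `positivePartCoeff_rec`. It remains to compare them at `a = 0` and at `b
= 0`. -/
theorem binomialTransform_positivePartCoeff (a b : ℕ) :
    binomialTransform (fun k => binomialTransform (positivePartCoeff k) b) a =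
      max ((a : ℝ) - b - 1) 0 := by
  induction b generalizing a with
  | zero =>
    simp only [binomialTransform_zero]
    rcases a with _ | a
    · simp [binomialTransform_zero, positivePartCoeff]
    -- At `b = 0` the coefficients are `(-1) ^ k` from `k = 2` on; adding the shift leaves only `k =
    -- 1`, whose transform at `a` is `a = (a + 1) - 0 - 1`.
    · have h : ∀ k, positivePartCoeff k 0 + positivePartCoeff (k + 1) 0 =
          if k = 1 then 1 else 0 := by
        rintro (_ | _ | k)
        · simp [positivePartCoeff]
        · simp [positivePartCoeff]
        · simp [positivePartCoeff, pow_succ]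
      rw [binomialTransform_succ]
      simp only [h]
      rw [binomialTransform_eq_sum_range _ (show a < a + 2 by omega)]
      simp
  | succ b ih =>
    rcases a with _ | a
    · rw [binomialTransform_zero, max_eq_right (by push_cast; linarith [(b.cast_nonneg : (0 : ℝ) ≤ b)])]
      simp [binomialTransform, positivePartCoeff]
    · rw [binomialTransform_succ]
      have h : ∀ k, binomialTransform (positivePartCoeff k) (b + 1) +
          binomialTransform (positivePartCoeff (k + 1)) (b + 1) =
            binomialTransform (positivePartCoeff k) b := by
        intro k
        rw [binomialTransform_succ, binomialTransform_succ, ← binomialTransform_add]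
        congr 1
        funext s
        linarith [positivePartCoeff_rec k s]
      simp only [h, ih]
      congr 1
      push_cast
      ring

/-- Binomial coefficients vanish beyond their upper index, so the summation bounds can be chosen
independently of the random pattern. -/
theorem sum_sum_choose_eq_max {a b K S : ℕ} (ha : a ≤ K) (hb : b < S) :
    ∑ s ∈ Finset.range S, ∑ k ∈ Finset.Icc 2 K,
      (-1 : ℝ) ^ (s + k) * ((s + k - 2).choose s : ℝ) * ((a.choose k : ℝ) * (b.choose s : ℝ)) =
        max ((a : ℝ) - b - 1) 0 := by
  rw [← binomialTransform_positivePartCoeff,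
    binomialTransform_eq_sum_range _ (Nat.lt_succ_of_le ha), Finset.sum_comm]
  have hsub : Finset.Icc 2 K ⊆ Finset.range (K + 1) := fun k hk => by
    simp only [Finset.mem_Icc, Finset.mem_range] at *
    omega
  rw [← Finset.sum_subset hsub]
  · refine Finset.sum_congr rfl fun k hk => ?_
    rw [binomialTransform_eq_sum_range _ hb, Finset.sum_mul]
    refine Finset.sum_congr rfl fun s _ => ?_
    rw [positivePartCoeff, if_pos (Finset.mem_Icc.1 hk).1]
    ring
  · intro k hk hk2
    have : ¬ 2 ≤ k := fun h => hk2 (Finset.mem_Icc.2 ⟨h, Nat.lt_succ_iff.1 (Finset.mem_range.1 hk)⟩)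
    simp [binomialTransform, positivePartCoeff, this]

/-! ### The probability of the Alabama paradox -/

section Paradox

variable {m : ℕ} {p : Fin m → ℝ}

/-- The states that are larger than state `i`. -/
noncomputable def largerStates (p : Fin m → ℝ) (i : Fin m) : Finset (Fin m) :=
  Finset.univ.filter fun j => p i < p j

/-- The states that are smaller than state `i`. -/
noncomputable def smallerStates (p : Fin m → ℝ) (i : Fin m) : Finset (Fin m) :=
  Finset.univ.filter fun j => p j < p i

/-- The probability that state `i` suffers from the Alabama paradox, as a sum over the possible
sets of indices `j` with `I j = 1`. -/
noncomputable def paradoxProbability (p : Fin m → ℝ) (i : Fin m) : ℝ :=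
  (m : ℝ)⁻¹ * ∑ T : Finset (Fin m), patternWeight (fun j => |p i - p j|) T *
    max (((largerStates p i ∩ T).card : ℝ) - (smallerStates p i ∩ T).card - 1) 0

theorem isParadoxProbability_paradoxProbability (hpos : ∀ i, 0 < p i) (hsum : ∑ i, p i = 1)
    (hlin : LinearIndependent ℚ p) (i : Fin m) :
    IsParadoxProbability p i (paradoxProbability p i) := by
  have h := isParadoxProbability_sum hpos hsum hlin i
  convert h using 2
  rw [paradoxProbability, ← sum_patternWeight_map_subtype (i := i) (by simp)]
  congr 1
  refine Finset.sum_congr rfl fun T _ => ?_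
  simp only [abs_sub_comm (p i)]
  congr 2
  have h1 : largerStates p i ∩ T.map (Function.Embedding.subtype _) =
      (T.filter fun j : {j // j ≠ i} => 0 < p j - p i).map (Function.Embedding.subtype _) := by
    ext j
    simp only [largerStates, Finset.mem_inter, Finset.mem_filter, Finset.mem_univ, true_and,
      Finset.mem_map, sub_pos]
    constructor
    · rintro ⟨h, l, hl, rfl⟩
      exact ⟨l, ⟨hl, h⟩, rfl⟩
    · rintro ⟨l, ⟨hl, h⟩, rfl⟩
      exact ⟨h, l, hl, rfl⟩
  have h2 : smallerStates p i ∩ T.map (Function.Embedding.subtype _) =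
      (T.filter fun j : {j // j ≠ i} => p j - p i < 0).map (Function.Embedding.subtype _) := by
    ext j
    simp only [smallerStates, Finset.mem_inter, Finset.mem_filter, Finset.mem_univ, true_and,
      Finset.mem_map, sub_neg]
    constructor
    · rintro ⟨h, l, hl, rfl⟩
      exact ⟨l, ⟨hl, h⟩, rfl⟩
    · rintro ⟨l, ⟨hl, h⟩, rfl⟩
      exact ⟨h, l, hl, rfl⟩
  rw [h1, h2, Finset.card_map, Finset.card_map, defectDrop]
  push_cast
  congr

theorem paradoxProbability_eq_integral (i : Fin m) {Ω : Type*} [MeasurableSpace Ω]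
    (P : Measure Ω) [IsProbabilityMeasure P] {I : Fin m → Ω → ℝ} (hI : iIndepFun I P)
    (hr : ∀ j, IsBernoulli P (I j) |p i - p j|) :
    paradoxProbability p i = 1 / (m : ℝ) *
      ∫ ω, max ((∑ j with p i < p j, I j ω) - (∑ j with p j < p i, I j ω) - 1) 0 ∂P := by
  have h := integral_pattern hI hr
    (fun x => max ((∑ j with p i < p j, x j) - (∑ j with p j < p i, x j) - 1) 0)
  rw [h, paradoxProbability, one_div]
  congr 1
  refine Finset.sum_congr rfl fun T _ => ?_
  have hcard : ∀ A : Finset (Fin m), ((A ∩ T).card : ℝ) =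
      ∑ j ∈ A, if j ∈ T then 1 else 0 := fun A => by
    rw [Finset.sum_boole, Finset.filter_mem_eq_inter]
  rw [hcard, hcard]
  simp only [largerStates, smallerStates]
  congr!

theorem paradoxProbability_eq_sum (hinj : Function.Injective p) (σ : Equiv.Perm (Fin m))
    (hσ : Antitone fun j => p (σ j)) (i : Fin m) :
    paradoxProbability p (σ i) = 1 / (m : ℝ) *
      ∑ s ∈ Finset.range (m - (i : ℕ)), ∑ k ∈ Finset.Icc 2 (i : ℕ),
        (-1 : ℝ) ^ (s + k) * ((s + k - 2).choose s : ℝ) *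
          elemSymm (Finset.Iio i) (fun j => |p (σ i) - p (σ j)|) k *
          elemSymm (Finset.Ioi i) (fun j => |p (σ i) - p (σ j)|) s := by
  have hanti : StrictAnti fun j => p (σ j) := hσ.strictAnti_of_injective (hinj.comp σ.injective)
  have hL : largerStates p (σ i) = (Finset.Iio i).map σ.toEmbedding := by
    ext j
    obtain ⟨j, rfl⟩ := σ.surjective j
    simpa [largerStates] using hanti.lt_iff_gt
  have hS : smallerStates p (σ i) = (Finset.Ioi i).map σ.toEmbedding := by
    ext j
    obtain ⟨j, rfl⟩ := σ.surjective j
    simpa [smallerStates] using hanti.lt_iff_gt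
  have he : ∀ (A : Finset (Fin m)) (k : ℕ), elemSymm A (fun j => |p (σ i) - p (σ j)|) k =
      ((A.map σ.toEmbedding).val.map fun j => |p (σ i) - p j|).esymm k := by
    intro A k
    simp [elemSymm, Finset.map_val, Multiset.map_map]
  have hdisj : Disjoint (largerStates p (σ i)) (smallerStates p (σ i)) :=
    Finset.disjoint_filter.2 fun j _ h => h.not_gt
  -- With positions counted from `0`, there are `i` larger and `m - 1 - i` smaller states, which
  -- fixes the ranges of `k` and `s`.
  have hcL : ∀ T, (largerStates p (σ i) ∩ T).card ≤ i := fun T =>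
    (Finset.card_le_card Finset.inter_subset_left).trans_eq (by rw [hL, Finset.card_map, Fin.card_Iio])
  have hcS : ∀ T, (smallerStates p (σ i) ∩ T).card < m - i := fun T =>
    ((Finset.card_le_card Finset.inter_subset_left).trans_eq
      (by rw [hS, Finset.card_map, Fin.card_Ioi])).trans_lt (by omega)
  rw [paradoxProbability, one_div]
  congr 1
  simp only [he, ← hL, ← hS, mul_assoc, ← sum_patternWeight_choose_mul_choose _ hdisj]
  simp only [← sum_sum_choose_eq_max (hcL _) (hcS _), Finset.mul_sum]
  rw [Finset.sum_comm]
  refine Finset.sum_congr rfl fun s _ => ?_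
  rw [Finset.sum_comm]
  refine Finset.sum_congr rfl fun k _ => Finset.sum_congr rfl fun T _ => ?_
  ring

end Paradox

theorem mainTheorem1 {m : ℕ} (p : Fin m → ℝ) (hpos : ∀ i, 0 < p i) (hsum : ∑ i, p i = 1)
    (hlin : LinearIndependent ℚ p) :
    ∃ q : Fin m → ℝ,
      -- `q i` is the asymptotic probability that state `i` suffers from the Alabama paradox
      (∀ i, IsParadoxProbability p i (q i)) ∧
      -- `q i = (1/m) E (S⁻ - S⁺ - 1)₊`, for any independent `I j` with law `Be(|p i - p j|)`
      (∀ (i : Fin m) (Ω : Type*) [MeasurableSpace Ω] (P : Measure Ω) [IsProbabilityMeasure P]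
        (I : Fin m → Ω → ℝ), iIndepFun I P → (∀ j, IsBernoulli P (I j) |p i - p j|) →
        q i = 1 / (m : ℝ) *
          ∫ ω, max ((∑ j with p i < p j, I j ω) - (∑ j with p j < p i, I j ω) - 1) 0 ∂P) ∧
      -- the explicit formula, where `σ` lists the states in decreasing order of size; the state
      -- in position `i + 1` of the list is `σ i`, as `Fin m` starts at `0`
      (∀ σ : Equiv.Perm (Fin m), Antitone (fun j => p (σ j)) → ∀ i : Fin m,
        q (σ i) = 1 / (m : ℝ) *
          ∑ s ∈ Finset.range (m - (i : ℕ)), ∑ k ∈ Finset.Icc 2 (i : ℕ),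
            (-1 : ℝ) ^ (s + k) * ((s + k - 2).choose s : ℝ) *
              elemSymm (Finset.Iio i) (fun j => |p (σ i) - p (σ j)|) k *
              elemSymm (Finset.Ioi i) (fun j => |p (σ i) - p (σ j)|) s) :=
  ⟨paradoxProbability p, isParadoxProbability_paradoxProbability hpos hsum hlin,
    fun i _ _ P _ _ hI hr => paradoxProbability_eq_integral i P hI hr,
    fun σ hσ i => paradoxProbability_eq_sum hlin.injective σ hσ i⟩
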